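/- **Theorem (Poncelet rotation number).** For a real symmetric $3\times 3$ matrix $C$ put $\mathcal C=\{(x,y)\in\mathbb R^2 : u^TCu=0,\ u=(x,y,1)^T\}$. Let $C_1,C_2$ be real symmetric $3\times3$ matrices such that 1. the upper-left $2\times2$ block of each $C_i$ is positive definite and $\det C_i<0$ (so that $\mathcal C_1,\mathcal C_2$ are ellipses); 2. $C_1^{-1}C_2$ has three distinct positive eigenvalues $\lambda_1>\lambda_2>\lambda_3>0$; 3. $\mathcal C_2$ lies inside $\mathcal C_1$: if $u\in\mathbb R^3\setminus\{0\}$ and $u^TC_2u=0$, then $u^TC_1u<0$. Let $\nu=(\nu_1,\nu_2)\in\mathbb R^2$ satisfy $\nu_2>0$ and $\nu_1+\lambda_3\nu_2>0$, and let $\mathcal C_\nu$ be the conic of $C_\nu=\nu_1C_1+\nu_2C_2$. Let $P_\nu:\mathcal C_1\to\mathcal C_1$ be the Poncelet map with caustic $\mathcal C_\nu$, i.e. the homeomorphism of $\mathcal C_1$ for which $P_\nu(z)$ is the unique point $w\in\mathcal C_1$, $w\ne z$, such that the segment from $z$ to $w$ is tangent to $\mathcal C_\nu$ with $\mathcal C_\nu$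 on the left when moving from $z$ to $w$. Then $P_\nu$ is well defined and its rotation number is $$\rho(\nu)=\frac{F(\omega(\nu),e)}{2K(e)},\qquad \omega(\nu)=\arcsin\sqrt{\frac{(\lambda_1-\lambda_3)\nu_2}{\lambda_1\nu_2+\nu_1}},\qquad e=\sqrt{\frac{\lambda_1-\lambda_2}{\lambda_1-\lambda_3}},$$ where $F(\phi,e)=\int_0^\phi \frac{d\tau}{\sqrt{1-e^2\sin^2\tau}}$ and $K(e)=F(\pi/2,e)$. Here the rotation number of an orientation-preserving homeomorphism $P$ of $\mathcal C_1$ is the number $\rho\in[0,1)$ with $\rho\equiv\lim_{n\to\infty}(f^n(t)-t)/n \pmod 1$, where $\mathcal C_1$ is identified with $\mathbb R/\mathbb Z$ by any counterclockwise parametrization and $f:\mathbb R\to\mathbb R$ is any continuous lift of $P$. -/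

import Mathlib

open Set Matrix

noncomputable section

namespace Poncelet

/-- The affine point `(x, y)` in homogeneous coordinates `(x, y, 1)`. -/
def homog (p : ℝ × ℝ) : Fin 3 → ℝ := ![p.1, p.2, 1]

/-- The value `uᵀ C u` of the quadratic form of `C`. -/
def quad (C : Matrix (Fin 3) (Fin 3) ℝ) (u : Fin 3 → ℝ) : ℝ := u ⬝ᵥ (C *ᵥ u)

/-- The conic `{(x, y) | uᵀ C u = 0, u = (x, y, 1)}` in the affine plane. -/
def conic (C : Matrix (Fin 3) (Fin 3) ℝ) : Set (ℝ × ℝ) := {p | quad C (homog p) = 0}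

/-- A symmetric matrix has ordered signature `(+, +, -)` if its upper-left `2 × 2` block is
positive definite and its determinant is negative. -/
structure HasOrderedSignature (C : Matrix (Fin 3) (Fin 3) ℝ) : Prop where
  isSymm : C.IsSymm
  posDef_block : ∀ x y : ℝ, (x, y) ≠ (0, 0) → 0 < quad C ![x, y, 0]
  det_neg : C.det < 0

/-- Two ellipses, with matrices normalised to ordered signature `(+, +, -)`, such that the
second ellipse lies in the interior of the first. -/
structure IsNestedPair (C₁ C₂ : Matrix (Fin 3) (Fin 3) ℝ) : Prop where
  outer : HasOrderedSignature C₁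
  inner : HasOrderedSignature C₂
  nested : ∀ u : Fin 3 → ℝ, u ≠ 0 → quad C₂ u = 0 → quad C₁ u < 0

/-- The element `ν₁ C₁ + ν₂ C₂` of the pencil generated by `C₁` and `C₂`. -/
def pencil (C₁ C₂ : Matrix (Fin 3) (Fin 3) ℝ) (ν₁ ν₂ : ℝ) : Matrix (Fin 3) (Fin 3) ℝ :=
  ν₁ • C₁ + ν₂ • C₂

/-- The determinant of the plane vectors `v` and `w`; it is positive exactly when `w` points to
the left of `v`. -/
def cross (v w : ℝ × ℝ) : ℝ := v.1 * w.2 - v.2 * w.1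

/-- The segment from `z` to `w` is tangent to the conic of `C`: it passes through a point `q` of
the conic at which the derivative of `p ↦ uᵀ C u`, `u = (p, 1)`, in the direction `w - z`
(for symmetric `C`, this is twice the expression below) vanishes. -/
def SegmentTangent (C : Matrix (Fin 3) (Fin 3) ℝ) (z w : ℝ × ℝ) : Prop :=
  z ≠ w ∧ ∃ q ∈ segment ℝ z w, q ∈ conic C ∧
    ![w.1 - z.1, w.2 - z.2, 0] ⬝ᵥ (C *ᵥ homog q) = 0

/-- The oriented segment from `z` to `w` is tangent to the conic of `C`, and the conic appears on
the left when moving from `z` to `w`. -/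
def PonceletStep (C : Matrix (Fin 3) (Fin 3) ℝ) (z w : ℝ × ℝ) : Prop :=
  SegmentTangent C z w ∧ ∀ p ∈ conic C, 0 ≤ cross (w - z) (p - z)

/-- `P` is the Poncelet map on the conic of `Co` with caustic the conic of `Ci`: `P z` is the
unique point `w` of the outer conic for which `z → w` is tangent to the inner one with positive
orientation. -/
def IsPonceletMap (Co Ci : Matrix (Fin 3) (Fin 3) ℝ) (P : conic Co → conic Co) : Prop :=
  ∀ z w : conic Co, P z = w ↔ PonceletStep Ci z w

/-- A counterclockwise parametrisation of the (strictly convex, closed) conic of `C` by the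
circle `ℝ / ℤ`, written as a `1`-periodic map on `ℝ`. The last condition says that the vertices
of a triangle met in increasing parameter order within one period are in counterclockwise order;
in particular the map is injective on each half-open period. -/
structure IsPositiveParam (C : Matrix (Fin 3) (Fin 3) ℝ) (γ : ℝ → conic C) : Prop where
  continuous : Continuous γ
  periodic : Function.Periodic γ 1
  surjective : Function.Surjective γ
  counterclockwise : ∀ t₀ t₁ t₂ : ℝ, t₀ < t₁ → t₁ < t₂ → t₂ < t₀ + 1 →
    0 < cross ((γ t₁ : ℝ × ℝ) - γ t₀) ((γ t₂ : ℝ × ℝ) - γ t₀)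

/-- `f` is a lift to `ℝ` of the map `P` of the conic, under the parametrisation `γ`. -/
def IsLift {C : Matrix (Fin 3) (Fin 3) ℝ} (γ : ℝ → conic C) (P : conic C → conic C)
    (f : CircleDeg1Lift) : Prop :=
  Continuous f ∧ ∀ t, γ (f t) = P (γ t)

/-- The rotation number of the orientation preserving map `P` of the conic is `ρ ∈ [0, 1)`:
`P` has a lift to the universal cover, and the translation number `lim (fⁿ t - t) / n` of every
lift `f`, under every counterclockwise parametrisation, is `ρ` modulo `1`. -/
def HasRotationNumber {C : Matrix (Fin 3) (Fin 3) ℝ} (P : conic C → conic C) (ρ : ℝ) : Prop :=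
  ρ ∈ Ico (0 : ℝ) 1 ∧
  (∃ γ f, IsPositiveParam C γ ∧ IsLift γ P f) ∧
  ∀ γ f, IsPositiveParam C γ → IsLift γ P f →
    ∃ m : ℤ, CircleDeg1Lift.translationNumber f = ρ + m

/-- The incomplete elliptic integral of the first kind, with modulus `e`. -/
def ellipticF (φ e : ℝ) : ℝ := ∫ τ in (0 : ℝ)..φ, 1 / √(1 - e ^ 2 * Real.sin τ ^ 2)

/-- The complete elliptic integral of the first kind, with modulus `e`. -/
def ellipticK (e : ℝ) : ℝ := ellipticF (Real.pi / 2) e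

/-- The pencil eccentricity, in terms of the eigenvalues of `C₁⁻¹ C₂`. -/
def pencilEccentricity (l₁ l₂ l₃ : ℝ) : ℝ := √((l₁ - l₂) / (l₁ - l₃))

/-- The amplitude `ω(ν)` associated with the element `ν` of the pencil. -/
def pencilAmplitude (l₁ l₃ ν₁ ν₂ : ℝ) : ℝ :=
  Real.arcsin √((l₁ - l₃) * ν₂ / (l₁ * ν₂ + ν₁))

end Poncelet

end

/-! A projective change of coordinates `M` turns the outer conic into the unit circle and, for every
`ν` at once, the caustic into the ellipse m₁X² + m₂Y² = m₃ with mᵢ = ν₁ + lᵢν₂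
(`IsNestedPair.exists_normal_form`). The chord between the angles a and b has unit normal at angle
(a + b)/2 and distance cos((b - a)/2) from the origin, so tangency is one trigonometric equation in
these two half-angles (`IsCircleChart.ponceletStep_point`).

The amplitude ω and the modulus e are the numbers with cos² ω = m₃/m₁ and 1 - e² sin² ω = m₂/m₁. In
these terms the tangency equation is Jacobi's addition theorem: it holds for a = am(u - s), b = am(u
+ s) with s = F(ω, e), whatever u is (`delta_sq_mul_cos_sq`). This is proved by finding first
integrals along u, using only am' = Δ(am).

Hence in the parameter t with angle am(4Kt), of period 1, the Poncelet map is the shift by 2s/(4K) =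
F(ω, e)/(2K). Since e does not involve `ν`, one parameter linearises the maps of the whole pencil. A
shift has its displacement as rotation number, and any other counterclockwise parameter is related
to this one by a degree one lift, which preserves translation numbers modulo 1
(`IsPositiveParam.hasRotationNumber`). -/

noncomputable section

namespace Poncelet

/-! ### Parametrisations, their lifts and the rotation number of a shift -/

section Dynamics

variable {C : Matrix (Fin 3) (Fin 3) ℝ} {γ γ' : ℝ → conic C}

theorem IsPositiveParam.ne_of_lt (h : IsPositiveParam C γ) {s t : ℝ} (hst : s < t)
    (hts : t < s + 1) : γ s ≠ γ t := by
  intro he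
  have := h.counterclockwise s t ((t + (s + 1)) / 2) hst (by linarith) (by linarith)
  simp [he, cross] at this

theorem IsPositiveParam.apply_add_int (h : IsPositiveParam C γ) (t : ℝ) (n : ℤ) :
    γ (t + n) = γ t := by
  simpa using h.periodic.int_mul n t

theorem IsPositiveParam.apply_eq_iff (h : IsPositiveParam C γ) {s t : ℝ} :
    γ s = γ t ↔ ∃ n : ℤ, t = s + n := by
  constructor
  · intro he
    refine ⟨⌊t - s⌋, ?_⟩
    have h1 : γ (t - ⌊t - s⌋) = γ t := by
      rw [← h.apply_add_int (t - ⌊t - s⌋) ⌊t - s⌋, sub_add_cancel]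
    by_contra hne
    have h2 := Int.floor_le (t - s)
    have h3 := Int.lt_floor_add_one (t - s)
    have h4 : s < t - ⌊t - s⌋ := lt_of_le_of_ne (by linarith) fun h => hne (by linarith)
    exact h.ne_of_lt h4 (by linarith) (he.trans h1.symm)
  · rintro ⟨n, rfl⟩
    exact (h.apply_add_int s n).symm

/-- The homeomorphism from `ℝ / ℤ` onto a conic induced by a counterclockwise parametrisation. -/
def IsPositiveParam.homeo (h : IsPositiveParam C γ) : AddCircle (1 : ℝ) ≃ₜ conic C :=
  Continuous.homeoOfEquivCompactToT2
    (f := Equiv.ofBijective h.periodic.lift <| by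
      constructor
      · intro x y
        induction x using QuotientAddGroup.induction_on with | _ x => ?_
        induction y using QuotientAddGroup.induction_on with | _ y => ?_
        intro hxy
        obtain ⟨n, rfl⟩ := h.apply_eq_iff.1 hxy
        refine QuotientAddGroup.eq.2 ⟨n, ?_⟩
        simp
      · intro p
        obtain ⟨t, rfl⟩ := h.surjective p
        exact ⟨t, rfl⟩)
    (continuous_coinduced_dom.2 h.continuous)

theorem IsPositiveParam.homeo_coe (h : IsPositiveParam C γ) (t : ℝ) :
    h.homeo (t : AddCircle (1 : ℝ)) = γ t := rfl

/-- The homeomorphism of a conic that shifts the parameter by `r`. -/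
def IsPositiveParam.shift (h : IsPositiveParam C γ) (r : ℝ) : conic C ≃ₜ conic C :=
  (h.homeo.symm.trans (Homeomorph.addRight (r : AddCircle (1 : ℝ)))).trans h.homeo

theorem IsPositiveParam.shift_apply (h : IsPositiveParam C γ) (r t : ℝ) :
    h.shift r (γ t) = γ (t + r) := by
  rw [← h.homeo_coe t, ← h.homeo_coe (t + r)]
  simp [IsPositiveParam.shift]

theorem IsPositiveParam.exists_lift (h : IsPositiveParam C γ) (h' : IsPositiveParam C γ') :
    ∃ g : ℝ → ℝ, Continuous g ∧ ∀ t, γ (g t) = γ' t := by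
  obtain ⟨e, he⟩ := h.surjective (γ' 0)
  let F : C(ℝ, AddCircle (1 : ℝ)) :=
    ⟨fun t => h.homeo.symm (γ' t), h.homeo.symm.continuous.comp h'.continuous⟩
  have h0 : ((e : ℝ) : AddCircle (1 : ℝ)) = F 0 := by
    simp only [F, ContinuousMap.coe_mk]
    rw [← he, ← h.homeo_coe, Homeomorph.symm_apply_apply]
  obtain ⟨g, ⟨-, hg⟩, -⟩ :=
    (AddCircle.isCoveringMap_coe (1 : ℝ)).existsUnique_continuousMap_lifts F 0 e h0
  refine ⟨g, g.continuous, fun t => ?_⟩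
  have := congrFun hg t
  simp only [Function.comp_apply, F, ContinuousMap.coe_mk] at this
  rw [← h.homeo_coe, this, Homeomorph.apply_symm_apply]

theorem cross_cycle (p q r : ℝ × ℝ) : cross (q - p) (r - p) = -cross (q - r) (p - r) := by
  simp only [cross, Prod.fst_sub, Prod.snd_sub]; ring

section Lift

variable (h : IsPositiveParam C γ) (h' : IsPositiveParam C γ') {g : ℝ → ℝ} (hg : Continuous g)
  (hgg : ∀ t, γ (g t) = γ' t)

include h h' hgg in
theorem lift_ne_add_int {s t : ℝ} (hst : s < t) (hts : t < s + 1) (n : ℤ) :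
    g t ≠ g s + n := by
  intro he
  apply h'.ne_of_lt hst hts
  rw [← hgg, ← hgg, he, h.apply_add_int]

include h h' hg hgg

/-- If `g` gained 1 before a full period, the intermediate value theorem would make `γ'` return to
its starting point too early. -/
theorem lift_sub_lt_one {s t : ℝ} (hst : s < t) (hts : t < s + 1) : g t < g s + 1 := by
  by_contra! hle
  obtain ⟨r, hr, hgr⟩ := intermediate_value_Icc hst.le hg.continuousOn
    (show g s + 1 ∈ Icc (g s) (g t) from ⟨by linarith, hle⟩)
  have hsr : s < r := lt_of_le_of_ne hr.1 (by rintro rfl; linarith)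
  exact lift_ne_add_int h h' hgg hsr (by linarith [hr.2]) 1 (by simpa using hgr)

theorem neg_one_lt_lift_sub {s t : ℝ} (hst : s < t) (hts : t < s + 1) : g s - 1 < g t := by
  by_contra! hle
  obtain ⟨r, hr, hgr⟩ := intermediate_value_Icc' hst.le hg.continuousOn
    (show g s - 1 ∈ Icc (g t) (g s) from ⟨hle, by linarith⟩)
  have hsr : s < r := lt_of_le_of_ne hr.1 (by rintro rfl; linarith)
  exact lift_ne_add_int h h' hgg hsr (by linarith [hr.2]) (-1) (by push_cast; linarith)

/-- Injectivity of `γ'` within a period makes `g` strictly monotone or strictly antitone there. In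
the antitone case a triangle of points would be counterclockwise for both `γ` and `γ'` with its
vertices in opposite orders. -/
theorem lift_lt {s t : ℝ} (hst : s < t) (hts : t < s + 1) : g s < g t := by
  have hinj : InjOn g (Icc s t) := by
    intro x hx y hy hxy
    rcases lt_trichotomy x y with hlt | rfl | hlt
    · exact absurd (by simpa using hxy.symm)
        (lift_ne_add_int h h' hgg hlt (by linarith [hx.1, hy.2]) 0)
    · rfl
    · exact absurd (by simpa using hxy)
        (lift_ne_add_int h h' hgg hlt (by linarith [hy.1, hx.2]) 0)
  rcases ContinuousOn.strictMonoOn_of_injOn_Icc' hst.le hg.continuousOn hinj with hm | hm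
  · exact hm (left_mem_Icc.2 hst.le) (right_mem_Icc.2 hst.le) hst
  · exfalso
    have hmid : (s + t) / 2 ∈ Icc s t := ⟨by linarith, by linarith⟩
    have h1 := hm (left_mem_Icc.2 hst.le) hmid (by linarith)
    have h2 := hm hmid (right_mem_Icc.2 hst.le) (by linarith)
    have h3 := neg_one_lt_lift_sub h h' hg hgg hst hts
    have h4 := h.counterclockwise _ _ _ h2 h1 (by linarith)
    have h5 := h'.counterclockwise s ((s + t) / 2) t (by linarith) (by linarith) hts
    rw [hgg, hgg, hgg] at h4
    rw [cross_cycle] at h5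
    linarith

theorem lift_add_one (t : ℝ) : g (t + 1) = g t + 1 := by
  obtain ⟨n, hn⟩ : ∃ n : ℤ, g (t + 1) = g t + n := by
    rw [← h.apply_eq_iff, hgg, hgg, h'.periodic]
  -- Each half period raises `g` by an amount strictly between 0 and 1, so the integer `n` lies
  -- strictly between 0 and 2.
  have h1 := lift_lt h h' hg hgg (s := t) (t := t + 1 / 2) (by linarith) (by linarith)
  have h2 := lift_lt h h' hg hgg (s := t + 1 / 2) (t := t + 1) (by linarith) (by linarith)
  have h3 := lift_sub_lt_one h h' hg hgg (s := t) (t := t + 1 / 2) (by linarith) (by linarith)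
  have h4 := lift_sub_lt_one h h' hg hgg (s := t + 1 / 2) (t := t + 1) (by linarith) (by linarith)
  have h5 : (0 : ℝ) < n := by linarith
  have h6 : (n : ℝ) < 2 := by linarith
  have h7 : n = 1 := by
    have : 0 < n := by exact_mod_cast h5
    have : n < 2 := by exact_mod_cast h6
    omega
  rw [hn, h7, Int.cast_one]

theorem lift_add_nat (t : ℝ) (n : ℕ) : g (t + n) = g t + n := by
  induction n with
  | zero => simp
  | succ n ih => push_cast; rw [← add_assoc, lift_add_one h h' hg hgg, ih, add_assoc]

theorem monotone_lift : Monotone g := by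
  intro s t hst
  have h0 : (⌊t - s⌋₊ : ℝ) ≤ t - s := Nat.floor_le (by linarith)
  have h1 := Nat.lt_floor_add_one (t - s)
  have h2 := lift_add_nat h h' hg hgg (t - ⌊t - s⌋₊) ⌊t - s⌋₊
  rw [sub_add_cancel] at h2
  have h3 : (0 : ℝ) ≤ (⌊t - s⌋₊ : ℝ) := Nat.cast_nonneg _
  rcases eq_or_lt_of_le (show s ≤ t - ⌊t - s⌋₊ by linarith) with h4 | h4
  · rw [← h4] at h2; linarith
  · linarith [lift_lt h h' hg hgg h4 (by linarith)]

end Lift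

theorem IsPositiveParam.exists_circleDeg1Lift (h : IsPositiveParam C γ)
    (h' : IsPositiveParam C γ') :
    ∃ g : CircleDeg1Lift, Continuous g ∧ ∀ t, γ (g t) = γ' t := by
  obtain ⟨g, hg, hgg⟩ := h.exists_lift h'
  exact ⟨⟨⟨g, monotone_lift h h' hg hgg⟩, lift_add_one h h' hg hgg⟩, hg, hgg⟩

theorem exists_int_of_continuous {f : ℝ → ℝ} (hf : Continuous f)
    (h : ∀ t, ∃ n : ℤ, f t = n) : ∃ n : ℤ, ∀ t, f t = n := by
  choose m hm using h
  have hcm : Continuous m := by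
    rw [Int.isClosedEmbedding_coe_real.isEmbedding.continuous_iff]
    exact hf.congr hm
  refine ⟨m 0, fun t => ?_⟩
  rw [hm, PreconnectedSpace.constant inferInstance hcm]

/-- A map that acts as the shift by `r` of some counterclockwise parameter has rotation
number `r`. -/
theorem IsPositiveParam.hasRotationNumber (h : IsPositiveParam C γ) {P : conic C → conic C}
    {r : ℝ} (hr : r ∈ Ico (0 : ℝ) 1) (hP : ∀ t, P (γ t) = γ (t + r)) : HasRotationNumber P r := by
  refine ⟨hr, ⟨γ, CircleDeg1Lift.translate (Multiplicative.ofAdd r), h, ?_, fun t => ?_⟩, ?_⟩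
  · exact (continuous_const.add continuous_id).congr fun t =>
      (CircleDeg1Lift.translate_apply r t).symm
  · rw [CircleDeg1Lift.translate_apply, hP, add_comm]
  · rintro γ' f h' ⟨hf, hfP⟩
    obtain ⟨g, hg, hgg⟩ := h.exists_circleDeg1Lift h'
    -- The defect of `g` in conjugating `f` to the translation by `r` is continuous and integer
    -- valued, hence constant: `g` semiconjugates `f` to the translation by `r + m`.
    obtain ⟨m, hm⟩ := exists_int_of_continuous (f := fun t => g (f t) - (g t + r))
      ((hg.comp hf).sub (hg.add continuous_const)) fun t => by
        obtain ⟨n, hn⟩ : ∃ n : ℤ, g (f t) = g t + r + n := by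
          rw [← h.apply_eq_iff, hgg, hfP, ← hgg, hP]
        exact ⟨n, by rw [hn]; ring⟩
    refine ⟨m, ?_⟩
    rw [← CircleDeg1Lift.translationNumber_translate (r + m)]
    refine CircleDeg1Lift.translationNumber_eq_of_semiconj (f := g) fun t => ?_
    rw [CircleDeg1Lift.translate_apply]
    linarith [hm t]

end Dynamics

/-! ### Elliptic integrals, the Jacobi amplitude and its addition theorem -/

/-- The function `√(1 - e² sin² φ)`. -/
def delta (e φ : ℝ) : ℝ := √(1 - e ^ 2 * Real.sin φ ^ 2)

/-- The Jacobi amplitude of modulus `e`, the inverse of `ellipticF · e`. -/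
def amplitude (e : ℝ) : ℝ → ℝ := Function.invFun fun φ => ellipticF φ e

section Elliptic

variable {e : ℝ} (he : e ^ 2 < 1)

include he

theorem one_sub_sq_mul_sin_sq_pos (φ : ℝ) : 0 < 1 - e ^ 2 * Real.sin φ ^ 2 := by
  nlinarith [Real.sin_sq_le_one φ, sq_nonneg e, sq_nonneg (Real.sin φ)]

theorem delta_pos (φ : ℝ) : 0 < delta e φ := Real.sqrt_pos.2 (one_sub_sq_mul_sin_sq_pos he φ)

theorem delta_sq (φ : ℝ) : delta e φ ^ 2 = 1 - e ^ 2 * Real.sin φ ^ 2 :=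
  Real.sq_sqrt (one_sub_sq_mul_sin_sq_pos he φ).le

theorem delta_le_one (φ : ℝ) : delta e φ ≤ 1 := by
  have := delta_sq he φ
  nlinarith [delta_pos he φ, mul_nonneg (sq_nonneg e) (sq_nonneg (Real.sin φ))]

theorem hasDerivAt_delta (φ : ℝ) :
    HasDerivAt (delta e) (-(e ^ 2 * Real.sin φ * Real.cos φ) / delta e φ) φ := by
  have h := ((((Real.hasDerivAt_sin φ).pow 2).const_mul (e ^ 2)).const_sub 1).sqrt
    (one_sub_sq_mul_sin_sq_pos he φ).ne'
  refine h.congr_deriv ?_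
  have := (delta_pos he φ).ne'
  simp only [delta, Pi.pow_apply] at this ⊢
  push_cast
  field_simp

theorem continuous_one_div_delta : Continuous fun φ => 1 / delta e φ := by
  refine continuous_const.div ?_ fun φ => (delta_pos he φ).ne'
  unfold delta
  fun_prop

theorem hasDerivAt_ellipticF (φ : ℝ) :
    HasDerivAt (fun φ => ellipticF φ e) (1 / delta e φ) φ :=
  (continuous_one_div_delta he).integral_hasStrictDerivAt 0 φ |>.hasDerivAt

omit he in
theorem ellipticF_zero : ellipticF 0 e = 0 := by simp [ellipticF]

theorem continuous_ellipticF : Continuous fun φ => ellipticF φ e :=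
  continuous_iff_continuousAt.2 fun φ => (hasDerivAt_ellipticF he φ).continuousAt

theorem strictMono_ellipticF : StrictMono fun φ => ellipticF φ e :=
  strictMono_of_deriv_pos fun φ => by
    rw [(hasDerivAt_ellipticF he φ).deriv]
    exact one_div_pos.2 (delta_pos he φ)

omit he in
theorem ellipticF_neg (φ : ℝ) : ellipticF (-φ) e = -ellipticF φ e := by
  unfold ellipticF
  rw [intervalIntegral.integral_symm, ← neg_zero, ← intervalIntegral.integral_comp_neg]
  simp

omit he in
theorem eq_of_hasDerivAt_zero {f : ℝ → ℝ} (h : ∀ x, HasDerivAt f 0 x) (x y : ℝ) : f x = f y :=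
  is_const_of_deriv_eq_zero (fun x => (h x).differentiableAt) (fun x => (h x).deriv) x y

theorem ellipticF_add_pi (φ : ℝ) :
    ellipticF (φ + Real.pi) e = ellipticF φ e + 2 * ellipticK e := by
  have h : ∀ x, HasDerivAt (fun φ => ellipticF (φ + Real.pi) e - ellipticF φ e) 0 x := by
    intro x
    refine (((hasDerivAt_ellipticF he (x + Real.pi)).comp_add_const x Real.pi).sub
      (hasDerivAt_ellipticF he x)).congr_deriv ?_
    simp [delta, Real.sin_add_pi]
  have h1 := eq_of_hasDerivAt_zero h φ (-(Real.pi / 2))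
  simp only [ellipticF_neg, show -(Real.pi / 2) + Real.pi = Real.pi / 2 by ring] at h1
  rw [ellipticK]
  linarith

/-- The integrand is at least 1. This gives surjectivity of the integral, hence a globally defined
amplitude, and positivity of K. -/
theorem self_le_ellipticF {φ : ℝ} (hφ : 0 ≤ φ) : φ ≤ ellipticF φ e := by
  have hm : Monotone fun φ => ellipticF φ e - φ :=
    monotone_of_hasDerivAt_nonneg (fun x => (hasDerivAt_ellipticF he x).sub (hasDerivAt_id x))
      fun x => by
        have := one_le_one_div (delta_pos he x) (delta_le_one he x)
        simpa using this
  have := hm hφ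
  simp only [ellipticF_zero] at this
  linarith

theorem surjective_ellipticF : Function.Surjective fun φ => ellipticF φ e := by
  have h1 : Filter.Tendsto (fun φ => ellipticF φ e) Filter.atTop Filter.atTop :=
    Filter.tendsto_atTop_mono' _ ((Filter.eventually_ge_atTop 0).mono fun φ hφ =>
      self_le_ellipticF he hφ) Filter.tendsto_id
  refine (continuous_ellipticF he).surjective h1 ?_
  have h2 := Filter.tendsto_neg_atTop_atBot.comp (h1.comp Filter.tendsto_neg_atBot_atTop)
  refine h2.congr fun φ => ?_
  simp [ellipticF_neg]

theorem ellipticF_amplitude (u : ℝ) : ellipticF (amplitude e u) e = u :=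
  Function.invFun_eq (surjective_ellipticF he u)

theorem amplitude_ellipticF (φ : ℝ) : amplitude e (ellipticF φ e) = φ :=
  (strictMono_ellipticF he).injective (ellipticF_amplitude he _)

theorem strictMono_amplitude : StrictMono (amplitude e) := fun u v huv => by
  rw [← (strictMono_ellipticF he).lt_iff_lt]
  simpa only [ellipticF_amplitude he] using huv

theorem continuous_amplitude : Continuous (amplitude e) :=
  (strictMono_amplitude he).monotone.continuous_of_surjective
    fun φ => ⟨_, amplitude_ellipticF he φ⟩

theorem hasDerivAt_amplitude (u : ℝ) :
    HasDerivAt (amplitude e) (delta e (amplitude e u)) u := by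
  have := (hasDerivAt_ellipticF he (amplitude e u)).of_local_left_inverse
    (continuous_amplitude he).continuousAt (one_div_pos.2 (delta_pos he _)).ne'
    (Filter.Eventually.of_forall fun v => ellipticF_amplitude he v)
  simpa using this

theorem amplitude_neg (u : ℝ) : amplitude e (-u) = -amplitude e u := by
  apply (strictMono_ellipticF he).injective
  simp only [ellipticF_neg, ellipticF_amplitude he]

theorem amplitude_add_two_mul_ellipticK (u : ℝ) :
    amplitude e (u + 2 * ellipticK e) = amplitude e u + Real.pi := by
  apply (strictMono_ellipticF he).injective
  simp only [ellipticF_add_pi he, ellipticF_amplitude he]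

theorem ellipticK_pos : 0 < ellipticK e :=
  (by positivity : (0 : ℝ) < Real.pi / 2).trans_le (self_le_ellipticF he (by positivity))

theorem hasDerivAt_delta_amplitude (u : ℝ) :
    HasDerivAt (fun u => delta e (amplitude e u))
      (-(e ^ 2 * Real.sin (amplitude e u) * Real.cos (amplitude e u))) u := by
  refine ((hasDerivAt_delta he _).comp u (hasDerivAt_amplitude he u)).congr_deriv ?_
  have := (delta_pos he (amplitude e u)).ne'
  field_simp

omit he in
theorem sin_mul_cos_add_sin_mul_cos (x y : ℝ) :
    Real.sin x * Real.cos x + Real.sin y * Real.cos y = Real.sin (x + y) * Real.cos (y - x) := by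
  rw [Real.sin_add, Real.cos_sub]
  linear_combination (-Real.sin x * Real.cos x) * Real.sin_sq_add_cos_sq y
    - (Real.sin y * Real.cos y) * Real.sin_sq_add_cos_sq x

omit he in
theorem sin_sq_sub_sin_sq (x y : ℝ) :
    Real.sin y ^ 2 - Real.sin x ^ 2 = Real.sin (x + y) * Real.sin (y - x) := by
  rw [Real.sin_add, Real.sin_sub]
  linear_combination (-Real.sin y ^ 2) * Real.sin_sq_add_cos_sq x
    + (Real.sin x ^ 2) * Real.sin_sq_add_cos_sq y

variable {s : ℝ} (hs : 0 < s) (hsK : s < ellipticK e)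

include hs hsK

theorem amplitude_sub_mem_Ioo (u : ℝ) :
    amplitude e (u + s) - amplitude e (u - s) ∈ Ioo 0 Real.pi := by
  have h1 := strictMono_amplitude he (show u - s < u + s by linarith)
  have h2 := strictMono_amplitude he (show u + s < u - s + 2 * ellipticK e by linarith)
  rw [amplitude_add_two_mul_ellipticK he] at h2
  exact ⟨by linarith, by linarith⟩

theorem sin_amplitude_sub_pos (u : ℝ) :
    0 < Real.sin (amplitude e (u + s) - amplitude e (u - s)) :=
  Real.sin_pos_of_mem_Ioo (amplitude_sub_mem_Ioo he hs hsK u)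

/-- With A = am(u - s), B = am(u + s), one has A' = Δ(A), B' = Δ(B), and the numerator of the
quotient rule cancels by the two preceding trigonometric identities. The right side is the value at
u = 0, where A = -am(s) and B = am(s). -/
theorem delta_add_delta_div_sin (u : ℝ) :
    (delta e (amplitude e (u - s)) + delta e (amplitude e (u + s))) /
        Real.sin (amplitude e (u + s) - amplitude e (u - s)) =
      2 * delta e (amplitude e s) / Real.sin (2 * amplitude e s) := by
  have key : ∀ u, HasDerivAt (fun u =>
      (delta e (amplitude e (u - s)) + delta e (amplitude e (u + s))) /
        Real.sin (amplitude e (u + s) - amplitude e (u - s))) 0 u := by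
    intro u
    have ha := (hasDerivAt_amplitude he (u - s)).comp_sub_const u s
    have hb := (hasDerivAt_amplitude he (u + s)).comp_add_const u s
    have hda := (hasDerivAt_delta_amplitude he (u - s)).comp_sub_const u s
    have hdb := (hasDerivAt_delta_amplitude he (u + s)).comp_add_const u s
    refine ((hda.add hdb).div (hb.sub ha).sin (sin_amplitude_sub_pos he hs hsK u).ne').congr_deriv ?_
    have h1 := sin_mul_cos_add_sin_mul_cos (amplitude e (u - s)) (amplitude e (u + s))
    have h2 := sin_sq_sub_sin_sq (amplitude e (u - s)) (amplitude e (u + s))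
    have h3 := delta_sq he (amplitude e (u - s))
    have h4 := delta_sq he (amplitude e (u + s))
    rw [div_eq_zero_iff]
    left
    simp only [Pi.add_apply, Pi.sub_apply]
    set A := amplitude e (u - s)
    set B := amplitude e (u + s)
    linear_combination (-e ^ 2 * Real.sin (B - A)) * h1 + e ^ 2 * Real.cos (B - A) * h2
      + Real.cos (B - A) * (h3 - h4)
  have := eq_of_hasDerivAt_zero key u 0
  simp only [zero_sub, zero_add, amplitude_neg he] at this
  rw [this]
  simp only [delta, Real.sin_neg, neg_sq]
  ring_nf

/-- The addition theorem in the form of the tangency condition. The first integral Δ(A) + Δ(B) = k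
sin(B - A) also determines Δ(B) - Δ(A) through the difference of squares; together they make k²
cos(B - A) + e² cos(A + B) constant. Comparison with u = 0 and half-angle formulas give the claim.
-/
theorem delta_sq_mul_cos_sq (u : ℝ) :
    delta e (amplitude e s) ^ 2 *
        Real.cos ((amplitude e (u + s) - amplitude e (u - s)) / 2) ^ 2 =
      Real.cos (amplitude e s) ^ 2 * (delta e (amplitude e s) ^ 2 *
          Real.cos ((amplitude e (u - s) + amplitude e (u + s)) / 2) ^ 2 +
        Real.sin ((amplitude e (u - s) + amplitude e (u + s)) / 2) ^ 2) := by
  set k := 2 * delta e (amplitude e s) / Real.sin (2 * amplitude e s) with hk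
  have hsum : ∀ u, delta e (amplitude e (u - s)) + delta e (amplitude e (u + s)) =
      k * Real.sin (amplitude e (u + s) - amplitude e (u - s)) := fun u =>
    (div_eq_iff (sin_amplitude_sub_pos he hs hsK u).ne').1 (delta_add_delta_div_sin he hs hsK u)
  have hS : 0 < Real.sin (2 * amplitude e s) := by
    have := sin_amplitude_sub_pos he hs hsK 0
    simpa [amplitude_neg he, two_mul] using this
  have hk0 : 0 < k := div_pos (by linarith [delta_pos he (amplitude e s)]) hS
  have hdiff : ∀ u, k * (delta e (amplitude e (u + s)) - delta e (amplitude e (u - s))) =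
      -e ^ 2 * Real.sin (amplitude e (u - s) + amplitude e (u + s)) := by
    intro u
    have h0 := (sin_amplitude_sub_pos he hs hsK u).ne'
    apply mul_right_cancel₀ h0
    linear_combination (-delta e (amplitude e (u + s)) + delta e (amplitude e (u - s))) * hsum u
      + delta_sq he (amplitude e (u + s)) - delta_sq he (amplitude e (u - s))
      - e ^ 2 * sin_sq_sub_sin_sq (amplitude e (u - s)) (amplitude e (u + s))
  have key : ∀ u, HasDerivAt (fun u =>
      k ^ 2 * Real.cos (amplitude e (u + s) - amplitude e (u - s)) +
        e ^ 2 * Real.cos (amplitude e (u - s) + amplitude e (u + s))) 0 u := by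
    intro u
    have ha := (hasDerivAt_amplitude he (u - s)).comp_sub_const u s
    have hb := (hasDerivAt_amplitude he (u + s)).comp_add_const u s
    refine (((hb.sub ha).cos.const_mul (k ^ 2)).add
      ((ha.add hb).cos.const_mul (e ^ 2))).congr_deriv ?_
    simp only [Pi.add_apply, Pi.sub_apply]
    have h1 := hsum u
    have h2 := hdiff u
    set A := amplitude e (u - s)
    set B := amplitude e (u + s)
    linear_combination (-k * Real.sin (B - A)) * h2 - e ^ 2 * Real.sin (A + B) * h1
  have hc := eq_of_hasDerivAt_zero key u 0
  simp only [zero_sub, zero_add, amplitude_neg he, sub_neg_eq_add, neg_add_cancel,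
    Real.cos_zero] at hc
  set A := amplitude e (u - s)
  set B := amplitude e (u + s)
  set w := amplitude e s
  have h1 : k * (Real.sin w * Real.cos w) = delta e w := by
    rw [hk, Real.sin_two_mul]
    rw [Real.sin_two_mul] at hS
    have h2 : Real.sin w ≠ 0 := by rintro h; simp [h] at hS
    have h3 : Real.cos w ≠ 0 := by rintro h; simp [h] at hS
    field_simp
  have e1 : Real.cos (B - A) = 2 * Real.cos ((B - A) / 2) ^ 2 - 1 := by
    rw [← Real.cos_two_mul]; ring_nf
  have e2 : Real.cos (A + B) = 1 - 2 * Real.sin ((A + B) / 2) ^ 2 := by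
    rw [Real.sin_sq, show A + B = 2 * ((A + B) / 2) by ring, Real.cos_two_mul]; ring_nf
  have e3 : Real.cos (w + w) = 2 * Real.cos w ^ 2 - 1 := by rw [← two_mul, Real.cos_two_mul]
  rw [e1, e2, e3] at hc
  have e4 := Real.sin_sq_add_cos_sq ((A + B) / 2)
  have e5 := delta_sq he w
  set cd := Real.cos ((B - A) / 2)
  set ss := Real.sin ((A + B) / 2)
  set cs := Real.cos ((A + B) / 2)
  have h6 : k ^ 2 * (cd ^ 2 - Real.cos w ^ 2) = e ^ 2 * ss ^ 2 := by linarith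
  have h7 : delta e w ^ 2 * (cd ^ 2 - Real.cos w ^ 2) =
      (Real.sin w * Real.cos w) ^ 2 * (e ^ 2 * ss ^ 2) := by
    rw [← h1, ← h6]; ring
  linear_combination h7 + Real.cos w ^ 2 * ss ^ 2 * e5 - Real.cos w ^ 2 * delta e w ^ 2 * e4

end Elliptic

/-! ### Simultaneous diagonalisation and normal form of the nested pair -/

theorem mulVec_dotProduct_mulVec (C N : Matrix (Fin 3) (Fin 3) ℝ) (a b : Fin 3 → ℝ) :
    (N *ᵥ a) ⬝ᵥ (C *ᵥ (N *ᵥ b)) = a ⬝ᵥ ((Nᵀ * C * N) *ᵥ b) := by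
  rw [dotProduct_comm, dotProduct_mulVec, ← mulVec_transpose, dotProduct_comm, mulVec_mulVec,
    mulVec_mulVec, Matrix.mul_assoc]

theorem dotProduct_diagonal_mulVec (d a b : Fin 3 → ℝ) :
    a ⬝ᵥ (diagonal d *ᵥ b) = d 0 * a 0 * b 0 + d 1 * a 1 * b 1 + d 2 * a 2 * b 2 := by
  simp only [dotProduct, mulVec_diagonal, Fin.sum_univ_three]
  ring

theorem quad_mulVec_of_diagonal {C N : Matrix (Fin 3) (Fin 3) ℝ} {d : Fin 3 → ℝ}
    (h : Nᵀ * C * N = diagonal d) (a : Fin 3 → ℝ) :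
    quad C (N *ᵥ a) = d 0 * a 0 ^ 2 + d 1 * a 1 ^ 2 + d 2 * a 2 ^ 2 := by
  rw [quad, mulVec_dotProduct_mulVec, h, dotProduct_diagonal_mulVec]
  ring

theorem HasOrderedSignature.quad_pos {C : Matrix (Fin 3) (Fin 3) ℝ} (h : HasOrderedSignature C)
    {u : Fin 3 → ℝ} (hu : u ≠ 0) (hu2 : u 2 = 0) : 0 < quad C u := by
  have h1 : u = ![u 0, u 1, 0] := by
    ext i; fin_cases i <;> simp [hu2]
  rw [h1]
  refine h.posDef_block _ _ fun h0 => hu ?_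
  rw [Prod.mk.injEq] at h0
  rw [h1, h0.1, h0.2]
  ext i; fin_cases i <;> rfl

theorem exists_sq_mul_eq_one {d x : ℝ} (hd : 0 < d) (hx : x ≠ 0) :
    ∃ c, c ^ 2 * d = 1 ∧ 0 < x * c := by
  have hx' : 0 < |x| := abs_pos.2 hx
  have hd' := Real.sqrt_pos.2 hd
  refine ⟨x / (|x| * √d), ?_, ?_⟩
  · rw [div_pow, mul_pow, sq_abs, Real.sq_sqrt hd.le]
    field_simp
  · rw [mul_div_assoc']
    exact div_pos (mul_self_pos.2 hx) (by positivity)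

/-- Eigenvectors of `C₁⁻¹ C₂` for distinct eigenvalues simultaneously diagonalise `C₁`
and `C₂`. -/
theorem exists_simultaneous_diagonal {C₁ C₂ : Matrix (Fin 3) (Fin 3) ℝ} (hs₁ : C₁.IsSymm)
    (hs₂ : C₂.IsSymm) (hdet : IsUnit C₁.det) {l : Fin 3 → ℝ} (hl : Function.Injective l)
    (h : ∀ i, Module.End.HasEigenvalue (Matrix.toLin' (C₁⁻¹ * C₂)) (l i)) :
    ∃ (N : Matrix (Fin 3) (Fin 3) ℝ) (d : Fin 3 → ℝ), N.det ≠ 0 ∧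
      Nᵀ * C₁ * N = diagonal d ∧ Nᵀ * C₂ * N = diagonal fun i => l i * d i := by
  choose v hv using fun i => (h i).exists_hasEigenvector
  have hli : LinearIndependent ℝ v :=
    Module.End.eigenvectors_linearIndependent' _ l hl v hv
  have hC : ∀ i, C₂ *ᵥ v i = l i • (C₁ *ᵥ v i) := by
    intro i
    have h1 := (hv i).apply_eq_smul
    rw [Matrix.toLin'_apply] at h1
    rw [← mulVec_smul, ← h1, mulVec_mulVec, ← Matrix.mul_assoc, mul_nonsing_inv _ hdet,
      Matrix.one_mul]
  have hsymm : ∀ {C : Matrix (Fin 3) (Fin 3) ℝ}, C.IsSymm → ∀ x y : Fin 3 → ℝ,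
      x ⬝ᵥ (C *ᵥ y) = y ⬝ᵥ (C *ᵥ x) := by
    intro C hC x y
    rw [dotProduct_mulVec, ← mulVec_transpose, hC.eq, dotProduct_comm]
  -- Evaluating the symmetric form of `C₂` on two eigenvectors in both orders gives (lⱼ - lᵢ)
  -- vᵢᵀC₁vⱼ = 0.
  have horth : ∀ i j, i ≠ j → v i ⬝ᵥ (C₁ *ᵥ v j) = 0 := by
    intro i j hij
    have h1 := hsymm hs₂ (v i) (v j)
    rw [hC, hC, dotProduct_smul, dotProduct_smul, hsymm hs₁ (v j), smul_eq_mul, smul_eq_mul,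
      ← sub_eq_zero, ← sub_mul] at h1
    exact (mul_eq_zero.1 h1).resolve_left (sub_ne_zero.2 fun h => hij (hl h).symm)
  have hentry : ∀ (C : Matrix (Fin 3) (Fin 3) ℝ) i j,
      ((Matrix.of v) * C * (Matrix.of v)ᵀ) i j = v i ⬝ᵥ (C *ᵥ v j) := by
    intro C i j
    rw [Matrix.mul_assoc]
    rfl
  have hd1 : ((Matrix.of v) * C₁ * (Matrix.of v)ᵀ) =
      diagonal fun i => v i ⬝ᵥ (C₁ *ᵥ v i) := by
    ext i j
    rw [hentry, diagonal_apply]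
    split_ifs with hij
    · rw [hij]
    · exact horth i j hij
  refine ⟨(Matrix.of v)ᵀ, fun i => v i ⬝ᵥ (C₁ *ᵥ v i), ?_, ?_, ?_⟩
  · rw [det_transpose]
    have h1 : IsUnit (Matrix.of v) := Matrix.linearIndependent_rows_iff_isUnit.1 hli
    exact ((Matrix.isUnit_iff_isUnit_det _).1 h1).ne_zero
  · rw [transpose_transpose, hd1]
  · rw [transpose_transpose]
    ext i j
    rw [hentry, diagonal_apply, hC, dotProduct_smul, smul_eq_mul]
    split_ifs with hij
    · rw [hij]
    · rw [horth i j hij, mul_zero]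

theorem IsNestedPair.exists_normal_form {C₁ C₂ : Matrix (Fin 3) (Fin 3) ℝ}
    (hC : IsNestedPair C₁ C₂) {l₁ l₂ l₃ : ℝ} (h₁₂ : l₂ < l₁) (h₂₃ : l₃ < l₂) (h₃ : 0 < l₃)
    (hl₁ : Module.End.HasEigenvalue (Matrix.toLin' (C₁⁻¹ * C₂)) l₁)
    (hl₂ : Module.End.HasEigenvalue (Matrix.toLin' (C₁⁻¹ * C₂)) l₂)
    (hl₃ : Module.End.HasEigenvalue (Matrix.toLin' (C₁⁻¹ * C₂)) l₃) :
    ∃ M : Matrix (Fin 3) (Fin 3) ℝ, 0 < M.det ∧ 0 < M 2 2 ∧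
      Mᵀ * C₁ * M = diagonal ![1, 1, -1] ∧ Mᵀ * C₂ * M = diagonal ![l₁, l₂, -l₃] := by
  obtain ⟨N, d, hN, hd₁, hd₂⟩ := exists_simultaneous_diagonal (l := ![l₁, l₂, l₃])
    hC.outer.isSymm hC.inner.isSymm (isUnit_iff_ne_zero.2 hC.outer.det_neg.ne)
    (by
      intro i j hij
      fin_cases i <;> fin_cases j <;> first | rfl | (exfalso; simp at hij; linarith))
    (by intro i; fin_cases i <;> assumption)
  have hinj : ∀ a, N *ᵥ a = 0 → a = 0 := fun a => eq_zero_of_mulVec_eq_zero hN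
  have hprod : d 0 * d 1 * d 2 < 0 := by
    have h1 := congrArg det hd₁
    rw [det_mul, det_mul, det_transpose, det_diagonal, Fin.prod_univ_three] at h1
    rw [← h1, mul_right_comm]
    exact mul_neg_of_pos_of_neg (mul_self_pos.2 hN) hC.outer.det_neg
  have hq₁ := quad_mulVec_of_diagonal hd₁
  have hq₂ := quad_mulVec_of_diagonal hd₂
  have hnest : ∀ a : Fin 3 → ℝ, a ≠ 0 →
      l₁ * d 0 * a 0 ^ 2 + l₂ * d 1 * a 1 ^ 2 + l₃ * d 2 * a 2 ^ 2 = 0 →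
      d 0 * a 0 ^ 2 + d 1 * a 1 ^ 2 + d 2 * a 2 ^ 2 < 0 := by
    intro a ha h0
    rw [← hq₁]
    refine hC.nested _ (fun h => ha (hinj a h)) ?_
    rw [hq₂]
    simpa using h0
  -- The test vector is chosen on the cone of `C₂`; there `C₁` takes the value -d₀d₂(l₁ - l₃), which
  -- would be positive, against nestedness.
  have h02 : 0 < d 2 → ¬ d 0 < 0 := by
    intro hp hn
    have e1 : 0 < l₃ * d 2 := by positivity
    have e2 : 0 < -(l₁ * d 0) := by nlinarith
    have h1 := hnest ![√(l₃ * d 2), 0, √(-(l₁ * d 0))]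
      (fun h => (Real.sqrt_pos.2 e1).ne' (congrFun h 0))
    simp only [cons_val_zero, cons_val_one, cons_val, Real.sq_sqrt e1.le, Real.sq_sqrt e2.le] at h1
    have h2 := h1 (by ring)
    have h3 := mul_pos (mul_pos hp (neg_pos.2 hn)) (sub_pos.2 (h₂₃.trans h₁₂))
    linarith
  have h12 : 0 < d 2 → ¬ d 1 < 0 := by
    intro hp hn
    have e1 : 0 < l₃ * d 2 := by positivity
    have e2 : 0 < -(l₂ * d 1) := by nlinarith
    have h1 := hnest ![0, √(l₃ * d 2), √(-(l₂ * d 1))]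
      (fun h => (Real.sqrt_pos.2 e1).ne' (congrFun h 1))
    simp only [cons_val_zero, cons_val_one, cons_val, Real.sq_sqrt e1.le, Real.sq_sqrt e2.le] at h1
    have h2 := h1 (by ring)
    have h3 := mul_pos (mul_pos hp (neg_pos.2 hn)) (sub_pos.2 h₂₃)
    linarith
  have hd2 : d 2 < 0 := by
    rcases lt_trichotomy (d 2) 0 with h | h | h
    · exact h
    · simp [h] at hprod
    · have := mul_nonneg (mul_nonneg (not_lt.1 (h02 h)) (not_lt.1 (h12 h))) h.le
      linarith
  have hd01 : 0 < d 0 * d 1 := pos_of_mul_neg_left hprod hd2.le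
  -- Otherwise all three entries are negative and `C₁` is negative definite, against its positive
  -- block.
  have hd0 : 0 < d 0 := by
    by_contra! hle
    have hd1 : d 1 < 0 := by
      by_contra! h
      linarith [mul_nonpos_of_nonpos_of_nonneg hle h]
    have h1 : N *ᵥ (N⁻¹ *ᵥ ![1, 0, 0]) = ![1, 0, 0] := by
      rw [mulVec_mulVec, mul_nonsing_inv _ (isUnit_iff_ne_zero.2 hN), one_mulVec]
    have h2 := hq₁ (N⁻¹ *ᵥ ![1, 0, 0])
    rw [h1] at h2
    have h3 := hC.outer.posDef_block 1 0 (by simp)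
    rw [h2] at h3
    linarith [mul_nonpos_of_nonpos_of_nonneg hle (sq_nonneg ((N⁻¹ *ᵥ ![1, 0, 0]) 0)),
      mul_nonpos_of_nonpos_of_nonneg hd1.le (sq_nonneg ((N⁻¹ *ᵥ ![1, 0, 0]) 1)),
      mul_nonpos_of_nonpos_of_nonneg hd2.le (sq_nonneg ((N⁻¹ *ᵥ ![1, 0, 0]) 2))]
  have hd1 : 0 < d 1 := pos_of_mul_pos_right hd01 hd0.le
  have hN22 : N 2 2 ≠ 0 := by
    intro h0
    have h1 : N *ᵥ ![0, 0, 1] ≠ 0 := fun h => by simpa using congrFun (hinj _ h) 2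
    have h2 := hC.outer.quad_pos h1 (by simp [mulVec, dotProduct, Fin.sum_univ_three, h0])
    rw [hq₁] at h2
    simp at h2
    linarith
  -- Normalising the entries to ±1 fixes each scale up to sign. The sign of `c2` makes the corner
  -- entry positive, and that of `c0` then makes the determinant positive.
  obtain ⟨c2, hc2, hc2'⟩ := exists_sq_mul_eq_one (neg_pos.2 hd2) hN22
  obtain ⟨c1, hc1, hc1'⟩ := exists_sq_mul_eq_one hd1 one_ne_zero
  have hne : N.det * c1 * c2 ≠ 0 := by
    refine mul_ne_zero (mul_ne_zero hN ?_) ?_ <;> rintro rfl <;> simp at *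
  obtain ⟨c0, hc0, hc0'⟩ := exists_sq_mul_eq_one hd0 hne
  have hscale : ∀ (C : Matrix (Fin 3) (Fin 3) ℝ) (x : Fin 3 → ℝ), Nᵀ * C * N = diagonal x →
      (N * diagonal ![c0, c1, c2])ᵀ * C * (N * diagonal ![c0, c1, c2]) =
        diagonal ![c0 ^ 2 * x 0, c1 ^ 2 * x 1, c2 ^ 2 * x 2] := by
    intro C x hx
    rw [transpose_mul, diagonal_transpose]
    have : diagonal ![c0, c1, c2] * Nᵀ * C * (N * diagonal ![c0, c1, c2]) =
        diagonal ![c0, c1, c2] * (Nᵀ * C * N) * diagonal ![c0, c1, c2] := by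
      simp only [Matrix.mul_assoc]
    rw [this, hx, diagonal_mul_diagonal, diagonal_mul_diagonal]
    congr 1
    ext i
    fin_cases i <;> simp <;> ring
  refine ⟨N * diagonal ![c0, c1, c2], ?_, ?_, ?_, ?_⟩
  · rw [det_mul, det_diagonal, Fin.prod_univ_three]
    simp only [cons_val_zero, cons_val_one, cons_val]
    linarith
  · rw [mul_diagonal]
    simpa using hc2'
  · rw [hscale C₁ d hd₁, hc0, hc1, show c2 ^ 2 * d 2 = -1 by linarith]
  · rw [hscale C₂ _ hd₂]
    congr 1
    ext i
    fin_cases i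
    · simp; linear_combination l₁ * hc0
    · simp; linear_combination l₂ * hc1
    · simp; linear_combination -l₃ * hc2

/-! ### Projective charts from the unit disc and orientation -/

/-- The affine point with homogeneous coordinates `u`. -/
def affinePoint (u : Fin 3 → ℝ) : ℝ × ℝ := (u 0 / u 2, u 1 / u 2)

/-- The point of the unit circle with angle `φ`, in homogeneous coordinates. -/
def circlePoint (φ : ℝ) : Fin 3 → ℝ := ![Real.cos φ, Real.sin φ, 1]

/-- An orientation preserving projective change of coordinates `M`, mapping the unit circle to
the conic of `C`. -/
structure IsCircleChart (C M : Matrix (Fin 3) (Fin 3) ℝ) : Prop where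
  signature : HasOrderedSignature C
  det_pos : 0 < M.det
  center_pos : 0 < M 2 2
  diag : Mᵀ * C * M = diagonal ![1, 1, -1]

theorem homog_affinePoint {u : Fin 3 → ℝ} (hu : u 2 ≠ 0) :
    homog (affinePoint u) = (u 2)⁻¹ • u := by
  ext i
  fin_cases i <;> simp [homog, affinePoint, div_eq_inv_mul, hu]

theorem affinePoint_eq_of_homog_eq_smul {p : ℝ × ℝ} {t : ℝ} {v : Fin 3 → ℝ}
    (h : homog p = t • v) : affinePoint v = p := by
  have h0 := congrFun h 0
  have h1 := congrFun h 1
  have h2 := congrFun h 2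
  simp [homog] at h0 h1 h2
  have ht : t ≠ 0 := by rintro rfl; simp at h2
  have hv : v 2 ≠ 0 := by intro h; simp [h] at h2
  ext
  · simp only [affinePoint]; rw [h0, div_eq_iff hv]; linear_combination v 0 * h2
  · simp only [affinePoint]; rw [h1, div_eq_iff hv]; linear_combination v 1 * h2

theorem quad_smul (C : Matrix (Fin 3) (Fin 3) ℝ) (t : ℝ) (u : Fin 3 → ℝ) :
    quad C (t • u) = t ^ 2 * quad C u := by
  simp only [quad, mulVec_smul, dotProduct_smul, smul_dotProduct, smul_eq_mul]
  ring

theorem quad_add_smul (C : Matrix (Fin 3) (Fin 3) ℝ) (k : ℝ) (u v : Fin 3 → ℝ) :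
    quad C (u + k • v) =
      quad C u + k * (u ⬝ᵥ (C *ᵥ v) + v ⬝ᵥ (C *ᵥ u)) + k ^ 2 * quad C v := by
  simp only [quad, mulVec_add, mulVec_smul, dotProduct_add, add_dotProduct, dotProduct_smul,
    smul_dotProduct, smul_eq_mul]
  ring

theorem affinePoint_mem_conic {C : Matrix (Fin 3) (Fin 3) ℝ} {u : Fin 3 → ℝ} (hu : u 2 ≠ 0)
    (h : quad C u = 0) : affinePoint u ∈ conic C := by
  rw [conic, mem_ofPred_eq, homog_affinePoint hu, quad_smul, h, mul_zero]

/-- The cross product is the determinant of the three homogeneous vectors, so `M` preserves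
orientation as soon as `M.det` and the scalars are positive. -/
theorem cross_eq_of_homog_eq_smul {M : Matrix (Fin 3) (Fin 3) ℝ} {p q r : ℝ × ℝ} {s t u : ℝ}
    {a b c : Fin 3 → ℝ} (hp : homog p = s • M *ᵥ a) (hq : homog q = t • M *ᵥ b)
    (hr : homog r = u • M *ᵥ c) :
    cross (q - p) (r - p) = s * t * u * M.det * (Matrix.of ![a, b, c]).det := by
  have h1 : cross (q - p) (r - p) = (Matrix.of ![homog p, homog q, homog r]).det := by
    simp [cross, det_fin_three, homog]; ring
  have h2 : Matrix.of ![homog p, homog q, homog r] =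
      diagonal ![s, t, u] * (Matrix.of ![a, b, c] * Mᵀ) := by
    rw [hp, hq, hr]
    ext i j
    rw [diagonal_mul]
    fin_cases i <;>
      simp [Matrix.mul_apply, mulVec, dotProduct, Fin.sum_univ_three, mul_comm]
  rw [h1, h2, det_mul, det_mul, det_diagonal, det_transpose, Fin.prod_univ_three]
  simp only [cons_val_zero, cons_val_one, cons_val]
  ring

theorem cos_eq_cos_midpoint (a b : ℝ) :
    Real.cos a = Real.cos ((a + b) / 2) * Real.cos ((b - a) / 2) +
        Real.sin ((a + b) / 2) * Real.sin ((b - a) / 2) ∧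
      Real.sin a = Real.sin ((a + b) / 2) * Real.cos ((b - a) / 2) -
        Real.cos ((a + b) / 2) * Real.sin ((b - a) / 2) ∧
      Real.cos b = Real.cos ((a + b) / 2) * Real.cos ((b - a) / 2) -
        Real.sin ((a + b) / 2) * Real.sin ((b - a) / 2) ∧
      Real.sin b = Real.sin ((a + b) / 2) * Real.cos ((b - a) / 2) +
        Real.cos ((a + b) / 2) * Real.sin ((b - a) / 2) := by
  rw [← Real.cos_sub, ← Real.sin_sub, ← Real.cos_add, ← Real.sin_add]
  ring_nf
  simp

/-- Chord length times the signed distance of (X, Y) from the chord, positive on the left side. -/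
theorem det_chord (a b X Y : ℝ) :
    (Matrix.of ![circlePoint a, circlePoint b, ![X, Y, 1]]).det =
      2 * Real.sin ((b - a) / 2) * (Real.cos ((b - a) / 2) -
        (X * Real.cos ((a + b) / 2) + Y * Real.sin ((a + b) / 2))) := by
  obtain ⟨h1, h2, h3, h4⟩ := cos_eq_cos_midpoint a b
  simp only [circlePoint, h1, h2, h3, h4, det_fin_three, of_apply, cons_val_zero, cons_val_one,
    cons_val]
  have := Real.sin_sq_add_cos_sq ((a + b) / 2)
  linear_combination
    2 * Real.sin ((b - a) / 2) * Real.cos ((b - a) / 2) * this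

theorem det_circlePoint_pos {a b c : ℝ} (hab : a < b) (hbc : b < c) (hca : c < a + 2 * Real.pi) :
    0 < (Matrix.of ![circlePoint a, circlePoint b, circlePoint c]).det := by
  rw [show circlePoint c = ![Real.cos c, Real.sin c, 1] from rfl, det_chord]
  have h1 : Real.cos ((b - a) / 2) -
      (Real.cos c * Real.cos ((a + b) / 2) + Real.sin c * Real.sin ((a + b) / 2)) =
      2 * Real.sin ((c - a) / 2) * Real.sin ((c - b) / 2) := by
    rw [← Real.cos_sub, Real.cos_sub_cos,
      show ((b - a) / 2 + (c - (a + b) / 2)) / 2 = (c - a) / 2 by ring,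
      show ((b - a) / 2 - (c - (a + b) / 2)) / 2 = -((c - b) / 2) by ring, Real.sin_neg]
    ring
  rw [h1]
  have h2 := Real.sin_pos_of_pos_of_lt_pi (x := (b - a) / 2) (by linarith) (by linarith)
  have h3 := Real.sin_pos_of_pos_of_lt_pi (x := (c - a) / 2) (by linarith) (by linarith)
  have h4 := Real.sin_pos_of_pos_of_lt_pi (x := (c - b) / 2) (by linarith) (by linarith)
  positivity

namespace IsCircleChart

variable {C M : Matrix (Fin 3) (Fin 3) ℝ} (h : IsCircleChart C M)

include h

theorem quad_mulVec (a : Fin 3 → ℝ) : quad C (M *ᵥ a) = a 0 ^ 2 + a 1 ^ 2 - a 2 ^ 2 := by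
  rw [quad_mulVec_of_diagonal h.diag]
  simp
  ring

theorem mulVec_inv_mulVec (u : Fin 3 → ℝ) : M *ᵥ (M⁻¹ *ᵥ u) = u := by
  rw [mulVec_mulVec, mul_nonsing_inv _ (isUnit_iff_ne_zero.2 h.det_pos.ne'), one_mulVec]

/-- The line sent to infinity misses the closed disc. Otherwise, moving from the centre towards (X,
Y), the third coordinate would vanish at some `s` in [0, 1], giving a point at infinity where the
form of `C` is at most 0, although it is positive there. -/
theorem mulVec_two_pos {X Y : ℝ} (hXY : X ^ 2 + Y ^ 2 ≤ 1) : 0 < (M *ᵥ ![X, Y, 1]) 2 := by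
  have hval : ∀ x y : ℝ, (M *ᵥ ![x, y, 1]) 2 = M 2 0 * x + M 2 1 * y + M 2 2 := by
    intro x y
    simp [mulVec, dotProduct, Fin.sum_univ_three]
  by_contra! hle
  rw [hval] at hle
  have hc := h.center_pos
  set m := M 2 0 * X + M 2 1 * Y
  have hm : 0 < -m := by linarith
  have hs : M 2 2 / -m ≤ 1 := (div_le_one hm).2 (by linarith)
  have hs0 : 0 ≤ M 2 2 / -m := by positivity
  set s := M 2 2 / -m with hsdef
  have h0 : (M *ᵥ ![s * X, s * Y, 1]) 2 = 0 := by
    rw [hval]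
    have : s * -m = M 2 2 := div_mul_cancel₀ _ hm.ne'
    linear_combination -this
  have hne : M *ᵥ ![s * X, s * Y, 1] ≠ 0 := fun h' => by
    simpa using congrFun (eq_zero_of_mulVec_eq_zero h.det_pos.ne' h') 2
  have h1 := h.signature.quad_pos hne h0
  rw [h.quad_mulVec] at h1
  simp only [cons_val_zero, cons_val_one, cons_val] at h1
  have h2 : s ^ 2 * (X ^ 2 + Y ^ 2) ≤ 1 :=
    mul_le_one₀ (pow_le_one₀ hs0 hs) (by positivity) hXY
  linarith

theorem circlePoint_two_pos (φ : ℝ) : 0 < (M *ᵥ circlePoint φ) 2 :=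
  h.mulVec_two_pos (by rw [Real.cos_sq_add_sin_sq])

/-- Every affine point in the closed disc bounded by the conic of `C` comes from a point of the
closed unit disc. -/
theorem exists_homog_eq {p : ℝ × ℝ} (hp : quad C (homog p) ≤ 0) :
    ∃ t X Y : ℝ, 0 < t ∧ X ^ 2 + Y ^ 2 ≤ 1 ∧ homog p = t • M *ᵥ ![X, Y, 1] := by
  set a := M⁻¹ *ᵥ homog p with ha
  have hMa : M *ᵥ a = homog p := h.mulVec_inv_mulVec _
  rw [← hMa, h.quad_mulVec] at hp
  have ha2 : a 2 ≠ 0 := by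
    intro h0
    rw [h0] at hp
    have e0 : a 0 = 0 := by nlinarith [sq_nonneg (a 0), sq_nonneg (a 1)]
    have e1 : a 1 = 0 := by nlinarith [sq_nonneg (a 0), sq_nonneg (a 1)]
    have e : a = 0 := by ext i; fin_cases i <;> assumption
    rw [e, mulVec_zero] at hMa
    simpa [homog] using congrFun hMa 2
  have hsm : homog p = a 2 • M *ᵥ ![a 0 / a 2, a 1 / a 2, 1] := by
    rw [← mulVec_smul, ← hMa]
    congr 1
    ext i
    fin_cases i <;> simp [mul_div_cancel₀, ha2]
  have hle : (a 0 / a 2) ^ 2 + (a 1 / a 2) ^ 2 ≤ 1 := by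
    rw [div_pow, div_pow, ← add_div, div_le_one (by positivity)]
    linarith
  refine ⟨a 2, a 0 / a 2, a 1 / a 2, ?_, hle, hsm⟩
  have h2 := congrFun hsm 2
  simp only [homog, cons_val, Pi.smul_apply, smul_eq_mul] at h2
  exact pos_of_mul_pos_left (by rw [← h2]; exact one_pos) (h.mulVec_two_pos hle).le

/-- The point of the conic of `C` with angle `φ` on the unit circle. -/
def point (φ : ℝ) : conic C :=
  ⟨affinePoint (M *ᵥ circlePoint φ), affinePoint_mem_conic (h.circlePoint_two_pos φ).ne' <| by
    rw [h.quad_mulVec]; simp [circlePoint]⟩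

theorem homog_point (φ : ℝ) : homog (h.point φ) =
    ((M *ᵥ circlePoint φ) 2)⁻¹ • M *ᵥ circlePoint φ :=
  homog_affinePoint (h.circlePoint_two_pos φ).ne'

theorem continuous_point : Continuous h.point := by
  have hc : ∀ i, Continuous fun φ => (M *ᵥ circlePoint φ) i := by
    intro i
    simp only [mulVec, dotProduct, Fin.sum_univ_three, circlePoint, cons_val_zero, cons_val_one,
      cons_val]
    fun_prop
  exact Continuous.subtype_mk (((hc 0).div (hc 2) fun φ => (h.circlePoint_two_pos φ).ne').prodMk
    ((hc 1).div (hc 2) fun φ => (h.circlePoint_two_pos φ).ne')) _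

theorem point_add_two_pi (φ : ℝ) : h.point (φ + 2 * Real.pi) = h.point φ := by
  simp [point, circlePoint]

theorem surjective_point : Function.Surjective h.point := by
  rintro ⟨p, hp⟩
  obtain ⟨t, X, Y, ht, -, hXY⟩ := h.exists_homog_eq (le_of_eq hp)
  have hp' : quad C (homog p) = 0 := hp
  rw [hXY, quad_smul, h.quad_mulVec, mul_eq_zero, or_iff_right (by positivity)] at hp'
  simp only [cons_val_zero, cons_val_one, cons_val] at hp'
  have hn : ‖(⟨X, Y⟩ : ℂ)‖ = 1 := by
    rw [Complex.norm_def, Complex.normSq_mk, Real.sqrt_eq_one]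
    linarith
  refine ⟨Complex.arg ⟨X, Y⟩, Subtype.ext ?_⟩
  have hcp : circlePoint (Complex.arg ⟨X, Y⟩) = ![X, Y, 1] := by
    rw [circlePoint, Complex.cos_arg (norm_pos_iff.1 (by rw [hn]; exact one_pos)),
      Complex.sin_arg, hn, div_one, div_one]
  simp only [point, hcp]
  exact affinePoint_eq_of_homog_eq_smul hXY

theorem cross_point_pos {a b c : ℝ} (hab : a < b) (hbc : b < c) (hca : c < a + 2 * Real.pi) :
    0 < cross ((h.point b : ℝ × ℝ) - h.point a) ((h.point c : ℝ × ℝ) - h.point a) := by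
  rw [cross_eq_of_homog_eq_smul (h.homog_point a) (h.homog_point b) (h.homog_point c)]
  have h1 := h.circlePoint_two_pos a
  have h2 := h.circlePoint_two_pos b
  have h3 := h.circlePoint_two_pos c
  have h4 := det_circlePoint_pos hab hbc hca
  have h5 := h.det_pos
  positivity

/-- The parametrisation of the conic by the normalised elliptic integral. -/
def ellipticParam (e : ℝ) (t : ℝ) : conic C := h.point (amplitude e (4 * ellipticK e * t))

theorem isPositiveParam_ellipticParam {e : ℝ} (he : e ^ 2 < 1) :
    IsPositiveParam C (h.ellipticParam e) where
  continuous := h.continuous_point.comp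
    ((continuous_amplitude he).comp (continuous_const.mul continuous_id))
  periodic t := by
    unfold ellipticParam
    rw [show 4 * ellipticK e * (t + 1) = 4 * ellipticK e * t + 2 * ellipticK e +
      2 * ellipticK e by ring, amplitude_add_two_mul_ellipticK he,
      amplitude_add_two_mul_ellipticK he, add_assoc, ← two_mul, h.point_add_two_pi]
  surjective p := by
    obtain ⟨φ, rfl⟩ := h.surjective_point p
    refine ⟨ellipticF φ e / (4 * ellipticK e), ?_⟩
    have := ellipticK_pos he
    rw [ellipticParam, mul_div_cancel₀ _ (by positivity), amplitude_ellipticF he]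
  counterclockwise t₀ t₁ t₂ h01 h12 h20 := by
    have hK := ellipticK_pos he
    refine h.cross_point_pos (strictMono_amplitude he (by gcongr))
      (strictMono_amplitude he (by gcongr)) ?_
    rw [two_mul, ← add_assoc, ← amplitude_add_two_mul_ellipticK he,
      ← amplitude_add_two_mul_ellipticK he]
    apply strictMono_amplitude he
    nlinarith

end IsCircleChart

/-! ### Uniqueness of the Poncelet step and the tangency criterion -/

/-- A conic meets a line in at most two points. -/
theorem HasOrderedSignature.eq_of_cross_eq_zero {C : Matrix (Fin 3) (Fin 3) ℝ}
    (h : HasOrderedSignature C) {z w₁ w₂ : ℝ × ℝ} (hz : z ∈ conic C) (h₁ : w₁ ∈ conic C)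
    (h₂ : w₂ ∈ conic C) (hz₁ : z ≠ w₁) (hz₂ : z ≠ w₂) (hc : cross (w₁ - z) (w₂ - z) = 0) :
    w₁ = w₂ := by
  have hne : (w₁.1 - z.1, w₁.2 - z.2) ≠ ((0, 0) : ℝ × ℝ) := by
    intro h0
    rw [Prod.mk.injEq, sub_eq_zero, sub_eq_zero] at h0
    exact hz₁ (Prod.ext h0.1.symm h0.2.symm)
  have hpos := h.posDef_block _ _ hne
  set v : Fin 3 → ℝ := ![w₁.1 - z.1, w₁.2 - z.2, 0] with hv
  have hn : 0 < (w₁.1 - z.1) ^ 2 + (w₁.2 - z.2) ^ 2 := by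
    by_contra! hle
    apply hne
    rw [Prod.mk.injEq]
    constructor <;> nlinarith [sq_nonneg (w₁.1 - z.1), sq_nonneg (w₁.2 - z.2)]
  simp only [cross, Prod.fst_sub, Prod.snd_sub] at hc
  obtain ⟨k, hk1, hk2⟩ : ∃ k : ℝ, w₂.1 - z.1 = k * (w₁.1 - z.1) ∧
      w₂.2 - z.2 = k * (w₁.2 - z.2) := by
    refine ⟨((w₁.1 - z.1) * (w₂.1 - z.1) + (w₁.2 - z.2) * (w₂.2 - z.2)) /
      ((w₁.1 - z.1) ^ 2 + (w₁.2 - z.2) ^ 2), ?_, ?_⟩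
    · rw [div_mul_eq_mul_div, eq_div_iff hn.ne']
      linear_combination -(w₁.2 - z.2) * hc
    · rw [div_mul_eq_mul_div, eq_div_iff hn.ne']
      linear_combination (w₁.1 - z.1) * hc
  have e1 : homog w₁ = homog z + (1 : ℝ) • v := by
    ext i; fin_cases i <;> simp [homog, hv]
  have e2 : homog w₂ = homog z + k • v := by
    ext i; fin_cases i <;> simp [homog, hv, ← hk1, ← hk2]
  have hz' : quad C (homog z) = 0 := hz
  have h1' : quad C (homog w₁) = 0 := h₁
  have h2' : quad C (homog w₂) = 0 := h₂
  rw [e1, quad_add_smul, hz'] at h1'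
  rw [e2, quad_add_smul, hz'] at h2'
  -- Along the line the form is a quadratic polynomial with roots 0 and 1 and leading coefficient
  -- `quad C v`; `k` is a further root.
  have hk : k * ((k - 1) * quad C v) = 0 := by linear_combination h2' - k * h1'
  have hk0 : k ≠ 0 := by
    rintro rfl
    exact hz₂ (Prod.ext (by linarith) (by linarith))
  have hk1' : k = 1 := by
    have := (mul_eq_zero.1 ((mul_eq_zero.1 hk).resolve_left hk0)).resolve_right hpos.ne'
    linarith
  rw [hk1'] at hk1 hk2
  exact Prod.ext (by linarith) (by linarith)

theorem PonceletStep.exists_mem_eq {D : Matrix (Fin 3) (Fin 3) ℝ} {z w : ℝ × ℝ}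
    (h : PonceletStep D z w) (hz : z ∉ conic D) :
    ∃ t : ℝ, 0 < t ∧ z + t • (w - z) ∈ conic D := by
  obtain ⟨⟨-, q, hq, hqD, -⟩, -⟩ := h
  rw [segment_eq_image'] at hq
  obtain ⟨t, ht, rfl⟩ := hq
  refine ⟨t, lt_of_le_of_ne ht.1 ?_, hqD⟩
  rintro rfl
  exact hz (by simpa using hqD)

/-- Each contact point lies ahead of `z` on its own ray and weakly to the left of the other ray. By
antisymmetry the cross product of the two directions vanishes, so both chords lie on one line. -/
theorem PonceletStep.unique {C D : Matrix (Fin 3) (Fin 3) ℝ} (hC : HasOrderedSignature C)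
    {z w₁ w₂ : ℝ × ℝ} (hz : z ∈ conic C) (h₁ : w₁ ∈ conic C) (h₂ : w₂ ∈ conic C)
    (hzD : z ∉ conic D) (hs₁ : PonceletStep D z w₁) (hs₂ : PonceletStep D z w₂) : w₁ = w₂ := by
  have hsmul : ∀ (t : ℝ) (v w : ℝ × ℝ), cross v (z + t • w - z) = t * cross v w := by
    intro t v w
    simp [cross]; ring
  obtain ⟨t₁, ht₁, hq₁⟩ := hs₁.exists_mem_eq hzD
  obtain ⟨t₂, ht₂, hq₂⟩ := hs₂.exists_mem_eq hzD
  have e1 := hs₁.2 _ hq₂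
  have e2 := hs₂.2 _ hq₁
  rw [hsmul] at e1 e2
  have e3 : cross (w₂ - z) (w₁ - z) = -cross (w₁ - z) (w₂ - z) := by simp only [cross]; ring
  have e4 := nonneg_of_mul_nonneg_right e1 ht₂
  have e5 := nonneg_of_mul_nonneg_right e2 ht₁
  exact hC.eq_of_cross_eq_zero hz h₁ h₂ hs₁.1.1 hs₂.1.1 (by linarith)

namespace IsCircleChart

variable {C D M : Matrix (Fin 3) (Fin 3) ℝ} (h : IsCircleChart C M) {m₁ m₂ m₃ : ℝ}
  (hD : Mᵀ * D * M = diagonal ![m₁, m₂, -m₃])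

include hD in
omit h in
theorem dotProduct_mulVec_of_diagonal (a b : Fin 3 → ℝ) :
    (M *ᵥ a) ⬝ᵥ (D *ᵥ (M *ᵥ b)) = m₁ * a 0 * b 0 + m₂ * a 1 * b 1 - m₃ * a 2 * b 2 := by
  rw [mulVec_dotProduct_mulVec, hD, dotProduct_diagonal_mulVec]
  simp
  ring

variable (h₃ : 0 < m₃) (h₃₂ : m₃ < m₂) (h₂₁ : m₂ ≤ m₁)

include h hD h₃ h₃₂ h₂₁

/-- On m₁X² + m₂Y² = m₃Z² the inequality X² + Y² ≥ Z² forces X = Y = Z = 0, because m₁ and m₂ exceed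
m₃ > 0. -/
theorem quad_neg_of_mem_conic {p : ℝ × ℝ} (hp : p ∈ conic D) : quad C (homog p) < 0 := by
  have hp' : quad D (homog p) = 0 := hp
  set a := M⁻¹ *ᵥ homog p with ha
  have hMa : M *ᵥ a = homog p := h.mulVec_inv_mulVec _
  rw [← hMa, quad, dotProduct_mulVec_of_diagonal hD] at hp'
  rw [← hMa, h.quad_mulVec]
  by_contra! hle
  have e0 : (m₁ - m₃) * a 0 ^ 2 = 0 := by
    nlinarith [mul_nonneg (sub_pos.2 (h₃₂.trans_le h₂₁)).le (sq_nonneg (a 0)),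
      mul_nonneg (sub_pos.2 h₃₂).le (sq_nonneg (a 1))]
  have e1 : (m₂ - m₃) * a 1 ^ 2 = 0 := by
    nlinarith [mul_nonneg (sub_pos.2 (h₃₂.trans_le h₂₁)).le (sq_nonneg (a 0)),
      mul_nonneg (sub_pos.2 h₃₂).le (sq_nonneg (a 1))]
  have e0' : a 0 = 0 :=
    pow_eq_zero_iff two_ne_zero |>.1 ((mul_eq_zero.1 e0).resolve_left (by linarith))
  have e1' : a 1 = 0 :=
    pow_eq_zero_iff two_ne_zero |>.1 ((mul_eq_zero.1 e1).resolve_left (by linarith))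
  have e2' : a 2 = 0 := by
    rw [e0', e1'] at hle
    nlinarith [sq_nonneg (a 2)]
  have e : a = 0 := by ext i; fin_cases i <;> assumption
  rw [e, mulVec_zero] at hMa
  simpa [homog] using congrFun hMa 2

/-- Two points of the outer conic are joined by a Poncelet step if the corresponding chord of the
unit circle is tangent to the ellipse `m₁ X² + m₂ Y² = m₃`, with the ellipse on the left. -/
theorem ponceletStep_point {a b : ℝ} (hsin : 0 < Real.sin ((b - a) / 2))
    (hcos : 0 < Real.cos ((b - a) / 2))
    (htan : m₁ * m₂ * Real.cos ((b - a) / 2) ^ 2 =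
      m₃ * (m₂ * Real.cos ((a + b) / 2) ^ 2 + m₁ * Real.sin ((a + b) / 2) ^ 2)) :
    PonceletStep D (h.point a) (h.point b) := by
  obtain ⟨ea1, ea2, eb1, eb2⟩ := cos_eq_cos_midpoint a b
  have hσ := Real.sin_sq_add_cos_sq ((a + b) / 2)
  have hδ := Real.sin_sq_add_cos_sq ((b - a) / 2)
  have hdet : ∀ X Y, (Matrix.of ![circlePoint a, circlePoint b, ![X, Y, 1]]).det =
      2 * Real.sin ((b - a) / 2) * (Real.cos ((b - a) / 2) -
        (X * Real.cos ((a + b) / 2) + Y * Real.sin ((a + b) / 2))) := det_chord a b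
  set sd := Real.sin ((b - a) / 2)
  set cd := Real.cos ((b - a) / 2)
  set ss := Real.sin ((a + b) / 2)
  set cs := Real.cos ((a + b) / 2)
  have hm₂ : 0 < m₂ := h₃.trans h₃₂
  have hm₁ : 0 < m₁ := hm₂.trans_le h₂₁
  have hua := h.circlePoint_two_pos a
  have hub := h.circlePoint_two_pos b
  have hcross : ∀ {t X Y : ℝ} {p : ℝ × ℝ}, homog p = t • M *ᵥ ![X, Y, 1] →
      cross ((h.point b : ℝ × ℝ) - h.point a) (p - h.point a) =
        ((M *ᵥ circlePoint a) 2)⁻¹ * ((M *ᵥ circlePoint b) 2)⁻¹ * t * M.det *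
          (2 * sd * (cd - (X * cs + Y * ss))) := by
    intro t X Y p hp
    rw [cross_eq_of_homog_eq_smul (h.homog_point a) (h.homog_point b) hp, hdet]
  have hMdet := h.det_pos
  refine ⟨⟨?_, ?_⟩, ?_⟩
  · intro heq
    -- The image of the centre lies strictly to the left of the chord, which is impossible if its
    -- endpoints coincide.
    have h0 : 0 < (M *ᵥ ![0, 0, 1]) 2 := h.mulVec_two_pos (by norm_num)
    have h1 := hcross (homog_affinePoint h0.ne')
    rw [heq] at h1
    simp only [cross, sub_self, Prod.fst_zero, Prod.snd_zero, zero_mul, add_zero, sub_zero] at h1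
    have : 0 < ((M *ᵥ circlePoint a) 2)⁻¹ * ((M *ᵥ circlePoint b) 2)⁻¹ *
        ((M *ᵥ ![0, 0, 1]) 2)⁻¹ * M.det * (2 * sd * cd) := by positivity
    linarith
  -- (X, Y) is the pole of the chord x cs + y ss = cd with respect to the ellipse; `htan` says that
  -- it lies on the chord, so it is the contact point.
  · set X := m₃ * cs / (m₁ * cd) with hX
    set Y := m₃ * ss / (m₂ * cd) with hY
    have eX : m₁ * X * cd = m₃ * cs := by rw [hX]; field_simp
    have eY : m₂ * Y * cd = m₃ * ss := by rw [hY]; field_simp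
    have eL : X * cs + Y * ss = cd := by
      have : (m₁ * m₂ * cd) * (X * cs + Y * ss - cd) = 0 := by
        linear_combination m₂ * cs * eX + m₁ * ss * eY - htan
      have := (mul_eq_zero.1 this).resolve_left (by positivity)
      linarith
    have eQ : m₁ * X ^ 2 + m₂ * Y ^ 2 = m₃ := by
      have : cd * (m₁ * X ^ 2 + m₂ * Y ^ 2 - m₃) = 0 := by
        linear_combination X * eX + Y * eY + m₃ * eL
      have := (mul_eq_zero.1 this).resolve_left (by positivity)
      linarith
    have eN : X ^ 2 + Y ^ 2 ≤ 1 := by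
      by_contra! hlt
      nlinarith [mul_nonneg (sub_nonneg.2 h₂₁) (sq_nonneg X), mul_pos hm₂ (sub_pos.2 hlt)]
    -- Position of the contact point along the chord in units of its half-length: -1 at `a`, 1 at
    -- `b`. Lying in the disc means |τ| ≤ 1.
    set τ := (Y * cs - X * ss) / sd with hτ
    have eτ : τ * sd = Y * cs - X * ss := div_mul_cancel₀ _ hsin.ne'
    have eX' : X = cs * cd - τ * sd * ss := by
      rw [eτ, ← eL]; linear_combination (-X) * hσ
    have eY' : Y = ss * cd + τ * sd * cs := by
      rw [eτ, ← eL]; linear_combination (-Y) * hσ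
    have hτ1 : τ ^ 2 ≤ 1 := by
      have h1 : X ^ 2 + Y ^ 2 = cd ^ 2 + τ ^ 2 * sd ^ 2 := by
        rw [eX', eY']; linear_combination (cd ^ 2 + τ ^ 2 * sd ^ 2) * hσ
      have h2 : 0 < sd ^ 2 := by positivity
      by_contra! hlt
      nlinarith [mul_pos (sub_pos.2 hlt) h2]
    obtain ⟨hτl, hτr⟩ := abs_le.1 ((sq_le_one_iff_abs_le_one τ).1 hτ1)
    have hcomb : (![X, Y, 1] : Fin 3 → ℝ) =
        ((1 - τ) / 2) • circlePoint a + ((1 + τ) / 2) • circlePoint b := by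
      ext i
      fin_cases i
      · simp [circlePoint, ea1, eb1]; linear_combination eX'
      · simp [circlePoint, ea2, eb2]; linear_combination eY'
      · simp [circlePoint]; ring
    have hq := h.mulVec_two_pos eN
    have hMcomb : M *ᵥ ![X, Y, 1] =
        ((1 - τ) / 2) • M *ᵥ circlePoint a + ((1 + τ) / 2) • M *ᵥ circlePoint b := by
      rw [hcomb, mulVec_add, mulVec_smul, mulVec_smul]
    have hcoord : ∀ i, (M *ᵥ ![X, Y, 1]) i = (1 - τ) / 2 * (M *ᵥ circlePoint a) i +
        (1 + τ) / 2 * (M *ᵥ circlePoint b) i := fun i => by rw [hMcomb]; simp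
    refine ⟨affinePoint (M *ᵥ ![X, Y, 1]), ?_, ?_, ?_⟩
    -- A projective map reweights convex combinations by third coordinates, which are positive here.
    · refine ⟨(1 - τ) / 2 * (M *ᵥ circlePoint a) 2 / (M *ᵥ ![X, Y, 1]) 2,
        (1 + τ) / 2 * (M *ᵥ circlePoint b) 2 / (M *ᵥ ![X, Y, 1]) 2, ?_, ?_, ?_, ?_⟩
      · exact div_nonneg (mul_nonneg (by linarith) hua.le) hq.le
      · exact div_nonneg (mul_nonneg (by linarith) hub.le) hq.le
      · rw [← add_div, ← hcoord, div_self hq.ne']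
      · have hua' := hua.ne'
        have hub' := hub.ne'
        have hq' := hq.ne'
        ext
        · simp only [affinePoint, point, Prod.fst_add, Prod.smul_fst, smul_eq_mul]
          rw [hcoord 0]
          field_simp
        · simp only [affinePoint, point, Prod.snd_add, Prod.smul_snd, smul_eq_mul]
          rw [hcoord 1]
          field_simp
    · refine affinePoint_mem_conic hq.ne' ?_
      rw [quad, dotProduct_mulVec_of_diagonal hD]
      simp only [cons_val_zero, cons_val_one, cons_val]
      linear_combination eQ
    · have hdir : ![(h.point b : ℝ × ℝ).1 - (h.point a : ℝ × ℝ).1,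
          (h.point b : ℝ × ℝ).2 - (h.point a : ℝ × ℝ).2, 0] =
          homog (h.point b) - homog (h.point a) := by
        ext i; fin_cases i <;> simp [homog]
      rw [hdir, h.homog_point, h.homog_point, homog_affinePoint hq.ne', mulVec_smul,
        dotProduct_smul, sub_dotProduct, smul_dotProduct, smul_dotProduct,
        dotProduct_mulVec_of_diagonal hD, dotProduct_mulVec_of_diagonal hD]
      simp only [circlePoint, cons_val_zero, cons_val_one, cons_val, ea1, ea2, eb1, eb2]
      -- Both endpoints are conjugate to the contact point, since the chord is its polar line; the
      -- derivative along their difference therefore vanishes.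
      have hA : m₁ * (cs * cd + ss * sd) * X + m₂ * (ss * cd - cs * sd) * Y - m₃ * 1 * 1 = 0 := by
        have : cd * (m₁ * (cs * cd + ss * sd) * X + m₂ * (ss * cd - cs * sd) * Y - m₃ * 1 * 1) = 0 := by
          linear_combination (cs * cd + ss * sd) * eX + (ss * cd - cs * sd) * eY + m₃ * cd * hσ
        exact (mul_eq_zero.1 this).resolve_left hcos.ne'
      have hB : m₁ * (cs * cd - ss * sd) * X + m₂ * (ss * cd + cs * sd) * Y - m₃ * 1 * 1 = 0 := by
        have : cd * (m₁ * (cs * cd - ss * sd) * X + m₂ * (ss * cd + cs * sd) * Y - m₃ * 1 * 1) = 0 := by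
          linear_combination (cs * cd - ss * sd) * eX + (ss * cd + cs * sd) * eY + m₃ * cd * hσ
        exact (mul_eq_zero.1 this).resolve_left hcos.ne'
      rw [hA, hB]
      simp
  · intro p hp
    obtain ⟨t, X, Y, ht, -, hXY⟩ :=
      h.exists_homog_eq (h.quad_neg_of_mem_conic hD h₃ h₃₂ h₂₁ hp).le
    have hp' : quad D (homog p) = 0 := hp
    rw [hXY, quad_smul, quad, dotProduct_mulVec_of_diagonal hD, mul_eq_zero,
      or_iff_right (by positivity)] at hp'
    simp only [cons_val_zero, cons_val_one, cons_val] at hp'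
    rw [hcross hXY]
    -- Cauchy–Schwarz for the ellipse: `htan` identifies `cd` with its support function in the
    -- direction (cs, ss).
    have hle : (X * cs + Y * ss) ^ 2 ≤ cd ^ 2 := by
      have h1 : 0 < m₁ * m₂ := by positivity
      refine le_of_mul_le_mul_left ?_ h1
      have h2 : m₁ * m₂ * cd ^ 2 - m₁ * m₂ * (X * cs + Y * ss) ^ 2 =
          (m₁ * X * ss - m₂ * Y * cs) ^ 2 := by
        linear_combination htan - (m₂ * cs ^ 2 + m₁ * ss ^ 2) * hp'
      nlinarith [sq_nonneg (m₁ * X * ss - m₂ * Y * cs)]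
    have := sub_nonneg.2 (le_of_sq_le_sq hle hcos.le)
    positivity

end IsCircleChart

/-! ### Conjugation of the Poncelet map to a rotation -/

/-- The Poncelet map with diagonalised caustic is conjugate to a rotation by a ratio of elliptic
integrals. -/
theorem IsCircleChart.exists_isPonceletMap {C D M : Matrix (Fin 3) (Fin 3) ℝ}
    (h : IsCircleChart C M) {m₁ m₂ m₃ : ℝ} (hD : Mᵀ * D * M = diagonal ![m₁, m₂, -m₃])
    (h₃ : 0 < m₃) (h₃₂ : m₃ < m₂) (h₂₁ : m₂ ≤ m₁) {e ω : ℝ} (he : e ^ 2 < 1)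
    (hω : ω ∈ Ioo 0 (Real.pi / 2)) (hcos : m₁ * Real.cos ω ^ 2 = m₃)
    (hdelta : m₁ * delta e ω ^ 2 = m₂) :
    ∃ P : conic C ≃ₜ conic C, IsPonceletMap C D P ∧
      HasRotationNumber P (ellipticF ω e / (2 * ellipticK e)) := by
  have hγ := h.isPositiveParam_ellipticParam he
  have hK := ellipticK_pos he
  have hm₁ : 0 < m₁ := (h₃.trans h₃₂).trans_le h₂₁
  set s := ellipticF ω e with hsdef
  have hs : 0 < s := by
    have := strictMono_ellipticF he hω.1
    simpa only [ellipticF_zero] using this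
  have hsK : s < ellipticK e := strictMono_ellipticF he hω.2
  have hstep : ∀ t, PonceletStep D (h.ellipticParam e t)
      (h.ellipticParam e (t + s / (2 * ellipticK e))) := by
    intro t
    -- Centring at u = 4Kt + s puts the endpoints of the step at u - s and u + s, the symmetric form
    -- of the addition theorem.
    have e1 : 4 * ellipticK e * t = 4 * ellipticK e * t + s - s := by ring
    have e2 : 4 * ellipticK e * (t + s / (2 * ellipticK e)) = 4 * ellipticK e * t + s + s := by
      field_simp; ring
    unfold ellipticParam
    rw [e2]
    nth_rw 1 [e1]
    generalize 4 * ellipticK e * t + s = u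
    obtain ⟨hl, hr⟩ := amplitude_sub_mem_Ioo he hs hsK u
    refine h.ponceletStep_point hD h₃ h₃₂ h₂₁
      (Real.sin_pos_of_pos_of_lt_pi (by linarith) (by linarith [Real.pi_pos]))
      (Real.cos_pos_of_mem_Ioo ⟨by linarith, by linarith⟩) ?_
    have key := delta_sq_mul_cos_sq he hs hsK u
    rw [hsdef, amplitude_ellipticF he, ← hsdef] at key
    rw [← hcos, ← hdelta]
    linear_combination m₁ ^ 2 * key
  refine ⟨hγ.shift (s / (2 * ellipticK e)), fun z w => ?_, hγ.hasRotationNumber ⟨by positivity, ?_⟩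
    (hγ.shift_apply _)⟩
  · obtain ⟨t, rfl⟩ := hγ.surjective z
    rw [hγ.shift_apply]
    constructor
    · rintro rfl
      exact hstep t
    · intro hw
      refine Subtype.ext (PonceletStep.unique h.signature (Subtype.coe_prop _)
        (Subtype.coe_prop _) (Subtype.coe_prop _) (fun hmem => ?_) (hstep t) hw)
      have hneg := h.quad_neg_of_mem_conic hD h₃ h₃₂ h₂₁ hmem
      have hzero : quad C (homog (h.ellipticParam e t)) = 0 := (h.ellipticParam e t).2
      linarith
  · rw [div_lt_one (by positivity)]
    linarith

end Poncelet

end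

theorem mainTheorem1 (C₁ C₂ : Matrix (Fin 3) (Fin 3) ℝ) (hC : Poncelet.IsNestedPair C₁ C₂)
    (l₁ l₂ l₃ : ℝ) (h₁₂ : l₂ < l₁) (h₂₃ : l₃ < l₂) (h₃ : 0 < l₃)
    (hl₁ : Module.End.HasEigenvalue (Matrix.toLin' (C₁⁻¹ * C₂)) l₁)
    (hl₂ : Module.End.HasEigenvalue (Matrix.toLin' (C₁⁻¹ * C₂)) l₂)
    (hl₃ : Module.End.HasEigenvalue (Matrix.toLin' (C₁⁻¹ * C₂)) l₃)
    (ν₁ ν₂ : ℝ) (hν₂ : 0 < ν₂) (hν : 0 < ν₁ + l₃ * ν₂) :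
    ∃ P : Poncelet.conic C₁ ≃ₜ Poncelet.conic C₁,
      Poncelet.IsPonceletMap C₁ (Poncelet.pencil C₁ C₂ ν₁ ν₂) P ∧
      Poncelet.HasRotationNumber P
        (Poncelet.ellipticF (Poncelet.pencilAmplitude l₁ l₃ ν₁ ν₂)
            (Poncelet.pencilEccentricity l₁ l₂ l₃) /
          (2 * Poncelet.ellipticK (Poncelet.pencilEccentricity l₁ l₂ l₃))) := by
  obtain ⟨M, hdet, hM, hM₁, hM₂⟩ := hC.exists_normal_form h₁₂ h₂₃ h₃ hl₁ hl₂ hl₃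
  have h13 : 0 < l₁ - l₃ := by linarith
  have hm₃₂ : l₃ * ν₂ < l₂ * ν₂ := by gcongr
  have hm₂₁ : l₂ * ν₂ < l₁ * ν₂ := by gcongr
  have hm₁ : 0 < l₁ * ν₂ + ν₁ := by linarith
  have he : Poncelet.pencilEccentricity l₁ l₂ l₃ ^ 2 = (l₁ - l₂) / (l₁ - l₃) :=
    Real.sq_sqrt (div_nonneg (by linarith) h13.le)
  have hx : 0 < (l₁ - l₃) * ν₂ / (l₁ * ν₂ + ν₁) := by positivity
  have hx1 : (l₁ - l₃) * ν₂ / (l₁ * ν₂ + ν₁) < 1 := by rw [div_lt_one hm₁]; linarith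
  have hr1 : √((l₁ - l₃) * ν₂ / (l₁ * ν₂ + ν₁)) < 1 := by
    rw [Real.sqrt_lt' one_pos]; simpa using hx1
  have hsin : Real.sin (Poncelet.pencilAmplitude l₁ l₃ ν₁ ν₂) ^ 2 =
      (l₁ - l₃) * ν₂ / (l₁ * ν₂ + ν₁) := by
    have hr0 := Real.sqrt_nonneg ((l₁ - l₃) * ν₂ / (l₁ * ν₂ + ν₁))
    rw [Poncelet.pencilAmplitude, Real.sin_arcsin (by linarith) hr1.le, Real.sq_sqrt hx.le]
  have he1 : Poncelet.pencilEccentricity l₁ l₂ l₃ ^ 2 < 1 := by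
    rw [he, div_lt_one h13]; linarith
  have hchart : Poncelet.IsCircleChart C₁ M := ⟨hC.outer, hdet, hM, hM₁⟩
  -- The pencil is diagonal in the same chart, with entries mᵢ = ν₁ + lᵢν₂ up to the last sign. From
  -- sin² ω = (m₁ - m₃)/m₁ and e² = (m₁ - m₂)/(m₁ - m₃) follow m₁ cos² ω = m₃ and m₁ Δ(ω)² = m₂.
  refine hchart.exists_isPonceletMap (m₁ := ν₁ + l₁ * ν₂) (m₂ := ν₁ + l₂ * ν₂)
    (m₃ := ν₁ + l₃ * ν₂) ?_ hν (by linarith) (by linarith) he1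
    ⟨Real.arcsin_pos.2 (Real.sqrt_pos.2 hx), Real.arcsin_lt_pi_div_two.2 hr1⟩ ?_ ?_
  · rw [Poncelet.pencil, Matrix.mul_add, Matrix.add_mul, Matrix.mul_smul, Matrix.smul_mul,
      Matrix.mul_smul, Matrix.smul_mul, hM₁, hM₂, ← Matrix.diagonal_smul, ← Matrix.diagonal_smul,
      Matrix.diagonal_add]
    congr 1
    ext i
    fin_cases i <;> simp <;> ring
  · rw [Real.cos_sq', hsin]
    field_simp
    ring
  · rw [Poncelet.delta_sq he1, hsin, he]
    field_simp
    ring
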